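/- **Definitions.** A *diagram* is a pair $(N,B)$ with $N$ a finite set and $B=(B_{ij})_{i,j\in N}$ a symmetric integer matrix with even diagonal entries; it is a *graph* if all $B_{ij}\ge 0$ and all $B_{ii}=0$. *Stokes circles.* An exponential factor at infinity is a finite sum $q=\sum_k a_k z^k$ with $a_k\in\mathbb C$ and positive rational exponents $k$. A Stokes circle $I=\langle q\rangle$ is an orbit of exponential factors under $\sum_k a_kz^k\mapsto\sum_k e^{2\pi i nk}a_kz^k$, $n\in\mathbb Z$. Its set of exponents is $E(I)=\{k: a_k\ne 0\}$, its ramification order $\mathrm{Ram}(I)$ is the lcm of the denominators of its exponents ($1$ for $q=0$), and the slope of $q$ is its largest exponent ($0$ for $q=0$). Put $\tau_l(q)=\sum_{k\ge l}a_kz^k$ and $\tau_l\langle q\rangle=\langle\tau_l(q)\rangle$. *Multiplicities.* For positive integers $r,r'$ and a finite set $S=\{k_0>\dots>k_t\}$ of positive rationals with $k_j=m_j/r=m_j'/r'$ and $m_j,m'_j$ integers, put $$\Lambda_{r,r'}(S)=\sum_{j=0}^{t} m_j\bigl(\gcd(r',m_0',\dots,m_{j-1}')-\gcd(r',m'_0,\dots,m'_j)\bigr),$$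 where the first gcd is $r'$ for $j=0$. For a Stokes circle $I$ with $r=\mathrm{Ram}(I)$, set $B_{I,I}=\Lambda_{r,r}(E(I))-r^2+1$. For distinct Stokes circles $I=\langle q\rangle$ and $J=\langle q'\rangle$ with ramification orders $r,r'$, let $k$ be the least positive element of $\frac1{\mathrm{lcm}(r,r')}\mathbb Z$ with $\tau_k(I)=\tau_k(J)$; let $q_d=q-\tau_k(q)$ and $q'_d=q'-\tau_k(q')$, and let $S=\{k_0>\dots>k_t\}$ be the set of exponents of $\tau_k(I)=\tau_k(J)$. If the slope $f$ of $q_d$ is at least that of $q'_d$, write $f=s_d/r$ and set $$B_{I,J}=\Lambda_{r,r'}(S)+s_d\gcd(r',m'_0,\dots,m'_t)-rr';$$ otherwise exchange the roles of $I$ and $J$. *Nonabelian Hodge diagrams.* Let $(E,\nabla)$ be an algebraic connection on the affine line over $\mathbb C$ with coordinate $z$, that is, a finitely generated projective $\mathbb C[z]$-module $E$ with an additive map $\nabla:E\to E$ such that $\nabla(fv)=f'v+f\nabla v$. Its irregular class at infinity is the finite multiset $\Theta=\sum n_iI_i$ of distinct Stokes circles $I_i$ with $n_i\ge1$ such that in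 some basis of $E$ there is a formal fundamental matrix of horizontal sections $g\,z^{L}e^{\mathrm{diag}(q_1,\dots,q_n)}$, with $g$ invertible over $\mathbb C((z^{-1/R}))$ for some integer $R\ge1$, the $q_j$ exponential factors that are polynomials in $z^{1/R}$, and $L$ a constant matrix commuting with $\mathrm{diag}(q_1,\dots,q_n)$, where each exponential factor in the orbit $I_i$ occurs exactly $n_i$ times among $q_1,\dots,q_n$ and no other exponential factor occurs. A diagram $(N,B)$ is a *nonabelian Hodge diagram* if there are such an $(E,\nabla)$ with irregular class $\Theta$ and a bijection $i\mapsto I_i$ from $N$ to the set of distinct Stokes circles of $\Theta$ with $B_{ij}=B_{I_i,I_j}$ for all $i,j\in N$. A *nonabelian Hodge graph* is a nonabelian Hodge diagram that is a graph. *Rescaling.* For a diagram $(N,B)$ and integers $r_i\ge1$ ($i\in N$), put $\widetilde B_{ij}=\frac{B_{ij}}{r_ir_j}$ for $i\ne j$ and $\widetilde B_{ii}=\frac{B_{ii}-1}{r_i^2}$. The *rescaled ultrametric condition* for $r$ is: for all pairwise distinct $i,j,k\in N$, if $\widetilde B_{ij}\le\widetilde B_{ik}\le\widetilde B_{jk}$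 then $\widetilde B_{ik}=\widetilde B_{jk}$. **Proposition.** There exist graphs that are not nonabelian Hodge graphs, hence also diagrams that are not nonabelian Hodge diagrams. For example, the triangle with vertices $i,j,k$, edge multiplicities $B_{ij}=B_{ik}=0$, $B_{jk}=1$ and no loops is a graph that is not a nonabelian Hodge graph, and it does not satisfy the rescaled ultrametric condition for any integers $r_i,r_j,r_k\ge1$. -/

import Mathlib

open Polynomial
open scoped LaurentSeries

noncomputable section

namespace NAH

/-! ### Diagrams, graphs, decorations -/

/-- A diagram `(N, B)`: a finite set `N` (here `V`) and a symmetric integer matrix `B` whose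
diagonal entries are even. For `i ≠ j`, `B i j` is the (possibly negative) number of edges between
`i` and `j`, and `B i i / 2` is the (possibly negative) number of loops at `i`. -/
structure Diagram where
  V : Type
  [fintypeV : Fintype V]
  B : Matrix V V ℤ
  symm : ∀ i j, B i j = B j i
  even_diag : ∀ i, Even (B i i)

/-- A graph is a diagram without loops and without negative edges. -/
def Diagram.IsGraph (Γ : Diagram) : Prop :=
  (∀ i j, 0 ≤ Γ.B i j) ∧ ∀ i, Γ.B i i = 0

open Classical in
/-- The rescaled edge/loop multiplicities of a diagram with respect to a decoration `r`. -/
def Diagram.rescaled (Γ : Diagram) (r : Γ.V → ℕ) (i j : Γ.V) : ℚ :=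
  if i = j then ((Γ.B i i : ℚ) - 1) / (r i : ℚ) ^ 2
  else (Γ.B i j : ℚ) / ((r i : ℚ) * (r j : ℚ))

/-- The ultrametric condition for the rescaled edge multiplicities of the decorated diagram
`(Γ, r)`: in every triangle the two largest rescaled multiplicities are equal. -/
def Diagram.RescaledUltrametric (Γ : Diagram) (r : Γ.V → ℕ) : Prop :=
  ∀ i j k : Γ.V, i ≠ j → i ≠ k → j ≠ k →
    Γ.rescaled r i j ≤ Γ.rescaled r i k → Γ.rescaled r i k ≤ Γ.rescaled r j k →
    Γ.rescaled r i k = Γ.rescaled r j k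

/-- The triangle with edge multiplicities `0, 0, 1` (and no loops). -/
def triangle : Diagram where
  V := Fin 3
  B := !![0, 0, 0; 0, 0, 1; 0, 1, 0]
  symm := by intro i j; fin_cases i <;> fin_cases j <;> rfl
  even_diag := by intro i; fin_cases i <;> exact ⟨0, rfl⟩

/-! ### Exponential factors and Stokes circles at infinity -/

/-- Exponential factors at infinity: Puiseux polynomials `q = ∑ a_k z ^ k` with finitely many
terms, whose exponents `k` are positive rational numbers (`q k` is the coefficient of `z ^ k`). -/
def ExpFactor : Type := {q : ℚ →₀ ℂ // ∀ k ∈ q.support, 0 < k}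

/-- The coefficient of `z ^ k` after `n` turns around infinity gets multiplied by this number. -/
def turn (n : ℤ) (k : ℚ) : ℂ := Complex.exp (2 * Real.pi * Complex.I * (n : ℂ) * (k : ℂ))

lemma turn_zero (k : ℚ) : turn 0 k = 1 := by simp [turn]

lemma turn_add (m n : ℤ) (k : ℚ) : turn (m + n) k = turn m k * turn n k := by
  simp only [turn, ← Complex.exp_add]
  congr 1
  push_cast
  ring

lemma turn_ne_zero (n : ℤ) (k : ℚ) : turn n k ≠ 0 := Complex.exp_ne_zero _

/-- Two exponential factors are Galois conjugate if one is obtained from the other by analytic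
continuation around infinity, `z ^ k ↦ exp (2 π i n k) z ^ k`. -/
def galoisSetoid : Setoid ExpFactor where
  r q q' := ∃ n : ℤ, ∀ k : ℚ, q'.1 k = turn n k * q.1 k
  iseqv :=
    { refl := fun q => ⟨0, fun k => by simp [turn_zero]⟩
      symm := by
        rintro q q' ⟨n, h⟩
        refine ⟨-n, fun k => ?_⟩
        rw [h k, ← mul_assoc, ← turn_add]
        simp [turn_zero]
      trans := by
        rintro q q' q'' ⟨n, h⟩ ⟨m, h'⟩
        refine ⟨m + n, fun k => ?_⟩
        rw [h' k, h k, turn_add, mul_assoc] }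

/-- Stokes circles at infinity, i.e. Galois orbits of exponential factors. -/
def StokesCircle : Type := Quotient galoisSetoid

/-- The Stokes circle `⟨q⟩` of an exponential factor `q`. -/
def circ (q : ExpFactor) : StokesCircle := Quotient.mk galoisSetoid q

/-- The truncation `τ_l q`, which keeps the monomials of exponent `≥ l`. -/
def ExpFactor.trunc (l : ℚ) (q : ExpFactor) : ExpFactor :=
  ⟨q.1.filter (fun k => l ≤ k), fun k hk => q.2 k (by
    rw [Finsupp.support_filter, Finset.mem_filter] at hk
    exact hk.1)⟩

/-- The truncation of a Stokes circle, `τ_l ⟨q⟩ = ⟨τ_l q⟩`. -/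
def StokesCircle.trunc (l : ℚ) : StokesCircle → StokesCircle :=
  Quotient.map (sa := galoisSetoid) (sb := galoisSetoid) (ExpFactor.trunc l) (by
    rintro q q' ⟨n, h⟩
    refine ⟨n, fun k => ?_⟩
    by_cases hk : l ≤ k
    · simp [ExpFactor.trunc, hk, h k]
    · simp [ExpFactor.trunc, hk])

/-- The set `E(I)` of exponents of a Stokes circle `I = ⟨q⟩`: those `k` for which `z ^ k` has a
nonzero coefficient in `q`. -/
def StokesCircle.exponents : StokesCircle → Finset ℚ :=
  Quotient.lift (s := galoisSetoid) (fun q => q.1.support) (by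
    rintro q q' ⟨n, h⟩
    ext k
    simp [h k, turn_ne_zero])

/-- The ramification order of an exponential factor: the least `r ≥ 1` such that `q` is a
polynomial in `z ^ (1 / r)`, that is, the lcm of the denominators of its exponents. -/
def ExpFactor.ram (q : ExpFactor) : ℕ := q.1.support.lcm Rat.den

/-- The ramification order of a Stokes circle. -/
def StokesCircle.ram (I : StokesCircle) : ℕ := I.exponents.lcm Rat.den

/-- The largest element of a finite set of positive exponents, `0` if the set is empty. -/
def slopeOf (S : Finset ℚ) : ℚ := if h : S.Nonempty then S.max' h else 0

/-! ### Loop and edge multiplicities -/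

/-- The integer `m` such that the positive exponent `k ∈ (1 / r) ℤ` is equal to `m / r`. -/
def numer (r : ℕ) (k : ℚ) : ℕ := (k * (r : ℚ)).num.natAbs

/-- `gcd (r, m_0, …, m_j)`, where `m_0 / r, …, m_j / r` are the elements of `S`;
it is `r` if `S` is empty. -/
def gcdOf (r : ℕ) (S : Finset ℚ) : ℕ := Nat.gcd r (S.gcd (numer r))

/-- For a set `S = {k_0 > … > k_t}` of exponents, with `k_j = m_j / r = m'_j / r'`, the sum over
`j = 0, …, t` of `m_j * (gcd (r', m'_0, …, m'_{j-1}) - gcd (r', m'_0, …, m'_j))`;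
the term of `j = 0` is `m_0 * (r' - gcd (r', m'_0))`. -/
def levelSum (r r' : ℕ) (S : Finset ℚ) : ℤ :=
  ∑ k ∈ S, (numer r k : ℤ) *
    ((gcdOf r' (S.filter (fun l => k < l)) : ℤ) - (gcdOf r' (S.filter (fun l => k ≤ l)) : ℤ))

/-- The loop multiplicity `B_{I,I}` of a Stokes circle. -/
def loopMult (I : StokesCircle) : ℤ :=
  levelSum I.ram I.ram I.exponents - (I.ram : ℤ) ^ 2 + 1

/-- The least positive element `l` of `(1 / lcm (r, r')) ℤ` such that `I` and `J` have the same
truncation `τ_l`. -/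
def commonIndex (I J : StokesCircle) : ℚ :=
  (sInf {n : ℕ | 0 < n ∧
      I.trunc ((n : ℚ) / (Nat.lcm I.ram J.ram : ℚ)) = J.trunc ((n : ℚ) / (Nat.lcm I.ram J.ram : ℚ))}
    : ℕ) / (Nat.lcm I.ram J.ram : ℚ)

/-- The common part `I_c = J_c` of `I` and `J` (written from `I`). -/
def commonPart (I J : StokesCircle) : StokesCircle := I.trunc (commonIndex I J)

/-- The slope of the different part `q_d = q - q_c` of `I = ⟨q⟩` with respect to `J`. -/
def diffSlope (I J : StokesCircle) : ℚ :=
  slopeOf (I.exponents.filter (fun k => k < commonIndex I J))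

/-- The edge multiplicity of two distinct Stokes circles `I`, `J` in the case
`diffSlope J I ≤ diffSlope I J`, so that the fission exponent is
`f = diffSlope I J = s_d / r` with `r = Ram I`; here `r' = Ram J`. -/
def edgeFormula (I J : StokesCircle) : ℤ :=
  levelSum I.ram J.ram (commonPart I J).exponents
    + (numer I.ram (diffSlope I J) : ℤ) * (gcdOf J.ram (commonPart I J).exponents : ℤ)
    - (I.ram : ℤ) * (J.ram : ℤ)

/-- The edge multiplicity `B_{I,J}` of two distinct Stokes circles. -/
def edgeMult (I J : StokesCircle) : ℤ :=
  if diffSlope J I ≤ diffSlope I J then edgeFormula I J else edgeFormula J I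

open Classical in
/-- The multiplicity `B_{I,J}` of any two Stokes circles. -/
def mult (I J : StokesCircle) : ℤ := if I = J then loopMult I else edgeMult I J

/-! ### Algebraic connections on the affine line and their irregular class at infinity -/

/-- An algebraic connection on the affine line with coordinate `z`: a vector bundle, i.e. a finitely
generated projective `ℂ[z]`-module `E`, with an additive map `nabla` (the covariant derivative along
`∂/∂z`) satisfying the Leibniz rule. -/
structure AlgConnection where
  E : Type
  [addCommGroup : AddCommGroup E]
  [module : Module ℂ[X] E]
  [finite : Module.Finite ℂ[X] E]
  [projective : Module.Projective ℂ[X] E]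
  nabla : E →+ E
  leibniz : ∀ (f : ℂ[X]) (v : E), nabla (f • v) = derivative f • v + f • nabla v

attribute [instance] AlgConnection.addCommGroup AlgConnection.module AlgConnection.finite
  AlgConnection.projective

/-- The derivation `z d/dz` on the field `ℂ((t))`, where `t ^ N = 1 / z`:
it maps `t ^ n` to `-(n / N) t ^ n`. -/
def euler (N : ℕ) (f : ℂ⸨X⸩) : ℂ⸨X⸩ where
  coeff n := -((n : ℂ) / (N : ℂ)) * f.coeff n
  isPWO_support' := f.isPWO_support.mono (by
    intro n hn
    rw [Function.mem_support] at hn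
    exact right_ne_zero_of_mul hn)

/-- A polynomial in `z` as an element of `ℂ((t))`, where `t ^ N = 1 / z`. -/
def polyAtInfinity (N : ℕ) (p : ℂ[X]) : ℂ⸨X⸩ :=
  Polynomial.aeval (HahnSeries.single (-(N : ℤ)) (1 : ℂ) : ℂ⸨X⸩) p

/-- An exponential factor whose ramification order divides `N`, as an element of `ℂ((t))`,
where `t ^ N = 1 / z`: the monomial `z ^ k` becomes `t ^ (-k N)`. -/
def ExpFactor.atInfinity (N : ℕ) (q : ExpFactor) : ℂ⸨X⸩ :=
  ∑ k ∈ q.1.support, HahnSeries.single (-(k * (N : ℚ)).num) (q.1 k)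

/-- The matrix `M` of a connection in a basis `b` of `E`: `∇ b_j = ∑ M_ij b_i`, so that
`∇ = d/dz + M` in the coordinates given by `b`. -/
def AlgConnection.matrix (C : AlgConnection) {n : ℕ} (b : Module.Basis (Fin n) ℂ[X] C.E) :
    Matrix (Fin n) (Fin n) ℂ[X] :=
  Matrix.of fun i j => b.repr (C.nabla (b j)) i

/-- The finite multiset `Θ = ∑ n_i I_i` of Stokes circles is the irregular class of the connection
at infinity. In a basis of `E`, and over `ℂ((t))` with `t ^ N = 1 / z` for a suitable `N ≥ 1`, the
horizontal sections have a formal fundamental matrix `g * z ^ L * exp (diag q)` (normal form of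
Turrittin and Levelt), with `g` invertible over `ℂ((t))`, `q` a family of exponential factors, and
`L` a constant matrix which commutes with `diag q`; and every exponential factor `p` occurs in
`q` as many times as the multiplicity of its Stokes circle `⟨p⟩` in `Θ`. -/
def AlgConnection.HasIrregularClass (C : AlgConnection) (Θ : StokesCircle →₀ ℕ) : Prop :=
  ∃ (n : ℕ) (b : Module.Basis (Fin n) ℂ[X] C.E) (N : ℕ) (g : Matrix (Fin n) (Fin n) ℂ⸨X⸩)
    (q : Fin n → ExpFactor) (L : Matrix (Fin n) (Fin n) ℂ),
    0 < N ∧ (∀ i, (q i).ram ∣ N) ∧ IsUnit g.det ∧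
    (∀ i j, q i ≠ q j → L i j = 0) ∧
    g.map (euler N)
        + g * (Matrix.diagonal (fun i => euler N ((q i).atInfinity N)) + L.map (fun c => (HahnSeries.C c : ℂ⸨X⸩)))
      = -((C.matrix b).map (fun f => polyAtInfinity N (Polynomial.X * f)) * g) ∧
    ∀ p : ExpFactor, Nat.card {i : Fin n // q i = p} = Θ (circ p)

/-! ### Nonabelian Hodge diagrams and graphs -/

/-- `Γ` is the core diagram `Γ_c(Θ)` of `Θ`: its vertices are identified with the distinct Stokes
circles of `Θ`, with the multiplicities `B_{I,I}`, `B_{I,J}` of these Stokes circles. -/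
def Diagram.IsCoreDiagram (Γ : Diagram) (Θ : StokesCircle →₀ ℕ) : Prop :=
  ∃ e : Γ.V ≃ {I : StokesCircle // I ∈ Θ.support},
    ∀ i j, Γ.B i j = mult (e i : StokesCircle) (e j : StokesCircle)

/-- `Γ` is the core diagram of an algebraic connection on the affine line. -/
def Diagram.IsNonabelianHodgeDiagram (Γ : Diagram) : Prop :=
  ∃ (C : AlgConnection) (Θ : StokesCircle →₀ ℕ), C.HasIrregularClass Θ ∧ Γ.IsCoreDiagram Θ

/-- A nonabelian Hodge graph is a nonabelian Hodge diagram that is a graph. -/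
def Diagram.IsNonabelianHodgeGraph (Γ : Diagram) : Prop :=
  Γ.IsNonabelianHodgeDiagram ∧ Γ.IsGraph

end NAH

end

/-
Every Stokes circle `⟨q⟩` with `r` sheets consists of the `r` Galois conjugates of `q`, and for
`I ≠ J` the number `B_{I,J} / (r r') + 1` is the average slope of the differences between the
conjugates of `q` and those of `q'`. If `q` and `q'` agree exactly above the exponent `f` (for the
best choice of representatives), this average is `𝔼 max (f, s)`, where `s` is the slope of `σ q - q`
for a random turn `σ`. So it increases with `f` for fixed `I`. Among three Stokes circles the two
largest fission exponents `f` coincide, hence the rescaled multiplicities of a nonabelian Hodge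
diagram satisfy the ultrametric condition with `r` the ramification orders, and the triangle
`0, 0, 1` does not satisfy it for any positive `r`.
-/

namespace NAH

/-! ### The average slope of the differences of conjugates -/

/-- The proportion of the turns around infinity that fix `z ^ k` for all `k ∈ S`: the turn by
`2 π n` does so if and only if `n` is a multiple of the denominators of all `k ∈ S`.
If `S = {m_0 / r, …, m_t / r}`, it is also `gcd (r, m_0, …, m_t) / r`. -/
def fixedProportion (S : Finset ℚ) : ℚ := ((S.lcm Rat.den : ℕ) : ℚ)⁻¹

/-- The proportion of the turns around infinity for which `k` is the largest exponent in `S`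
whose monomial is moved. -/
def topMovedProportion (S : Finset ℚ) (k : ℚ) : ℚ :=
  fixedProportion (S.filter (k < ·)) - fixedProportion (S.filter (k ≤ ·))

/-- The average slope of the differences between the Galois conjugates of two exponential factors
with fission exponent `f`, the first of which has the set of exponents `E`. -/
def averageSlope (E : Finset ℚ) (f : ℚ) : ℚ :=
  ∑ k ∈ E, max k f * topMovedProportion E k + f * fixedProportion E

lemma lcm_den_pos (S : Finset ℚ) : 0 < S.lcm Rat.den :=
  Nat.pos_of_ne_zero fun h ↦
    let ⟨k, _, hk⟩ := Finset.lcm_eq_zero_iff.1 h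
    k.den_nz hk

lemma fixedProportion_nonneg (S : Finset ℚ) : 0 ≤ fixedProportion S := by
  unfold fixedProportion
  positivity

lemma fixedProportion_antitone : Antitone fixedProportion := fun S T hST ↦
  inv_anti₀ (by exact_mod_cast lcm_den_pos S)
    (by exact_mod_cast Nat.le_of_dvd (lcm_den_pos T) (Finset.lcm_mono hST))

lemma topMovedProportion_nonneg (S : Finset ℚ) (k : ℚ) : 0 ≤ topMovedProportion S k :=
  sub_nonneg.2 <| fixedProportion_antitone <| Finset.monotone_filter_right S fun _ _ ↦ le_of_lt

lemma averageSlope_monotone (E : Finset ℚ) : Monotone (averageSlope E) := fun f f' h ↦ by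
  unfold averageSlope
  gcongr with k
  · exact topMovedProportion_nonneg E k
  · exact fixedProportion_nonneg E

lemma topMovedProportion_filter_lt (E : Finset ℚ) {f k : ℚ} (h : f < k) :
    topMovedProportion (E.filter (f < ·)) k = topMovedProportion E k := by
  have hlt : (E.filter (f < ·)).filter (k < ·) = E.filter (k < ·) := by
    rw [Finset.filter_filter]
    exact Finset.filter_congr fun l _ ↦ ⟨And.right, fun hl ↦ ⟨h.trans hl, hl⟩⟩
  have hle : (E.filter (f < ·)).filter (k ≤ ·) = E.filter (k ≤ ·) := by
    rw [Finset.filter_filter]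
    exact Finset.filter_congr fun l _ ↦ ⟨And.right, fun hl ↦ ⟨h.trans_le hl, hl⟩⟩
  rw [topMovedProportion, hlt, hle, topMovedProportion]

lemma sum_topMovedProportion (S : Finset ℚ) :
    ∑ k ∈ S, topMovedProportion S k = 1 - fixedProportion S := by
  induction S using Finset.induction_on_min with
  | empty => simp [fixedProportion]
  | insert a S ha ih =>
    have haS : a ∉ S := fun h ↦ lt_irrefl a (ha a h)
    have hlt : (insert a S).filter (a < ·) = S := by
      rw [Finset.filter_insert, if_neg (lt_irrefl a), Finset.filter_true_of_mem ha]
    have hle : (insert a S).filter (a ≤ ·) = insert a S :=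
      Finset.filter_true_of_mem <|
        (Finset.forall_mem_insert _ _ _).2 ⟨le_rfl, fun k hk ↦ (ha k hk).le⟩
    have hS : ∀ k ∈ S, topMovedProportion (insert a S) k = topMovedProportion S k := fun k hk ↦ by
      rw [← topMovedProportion_filter_lt _ (ha k hk), hlt]
    rw [Finset.sum_insert haS, Finset.sum_congr rfl hS, ih, topMovedProportion, hlt, hle]
    ring

lemma averageSlope_of_forall_lt {S : Finset ℚ} {f : ℚ} (h : ∀ k ∈ S, f < k) :
    averageSlope S f = ∑ k ∈ S, k * topMovedProportion S k + f * fixedProportion S := by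
  rw [averageSlope, Finset.sum_congr rfl fun k hk ↦ by rw [max_eq_left (h k hk).le]]

lemma averageSlope_filter_lt (E : Finset ℚ) (f : ℚ) :
    averageSlope (E.filter (f < ·)) f = averageSlope E f := by
  have hmoved : ∀ k ∈ E.filter (f < ·),
      topMovedProportion (E.filter (f < ·)) k = topMovedProportion E k := fun k hk ↦
    topMovedProportion_filter_lt E (Finset.mem_filter.1 hk).2
  have hhigh : ∑ k ∈ E.filter (f < ·), topMovedProportion E k
      = 1 - fixedProportion (E.filter (f < ·)) := by
    rw [← sum_topMovedProportion, Finset.sum_congr rfl hmoved]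
  have hlow : ∑ k ∈ E.filter (¬ f < ·), max k f * topMovedProportion E k
      = f * ∑ k ∈ E.filter (¬ f < ·), topMovedProportion E k := by
    rw [Finset.mul_sum]
    refine Finset.sum_congr rfl fun k hk ↦ ?_
    rw [max_eq_right (not_lt.1 (Finset.mem_filter.1 hk).2)]
  have htotal := sum_topMovedProportion E
  rw [← Finset.sum_filter_add_sum_filter_not E (f < ·), hhigh] at htotal
  rw [averageSlope, averageSlope, ← Finset.sum_filter_add_sum_filter_not E (f < ·), hlow,
    Finset.sum_congr rfl fun k hk ↦ by rw [hmoved k hk]]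
  linear_combination -f * htotal

/-! ### Level sums as proportions of turns -/

lemma numer_den_mul (k : ℚ) (c : ℕ) : numer (k.den * c) k = k.num.natAbs * c := by
  have h : k * ((k.den * c : ℕ) : ℚ) = ((k.num * c : ℤ) : ℚ) := by
    push_cast
    rw [← mul_assoc, Rat.mul_den_eq_num]
  rw [numer, h, Rat.num_intCast, Int.natAbs_mul, Int.natAbs_natCast]

lemma natCast_numer {r : ℕ} {k : ℚ} (hk : 0 ≤ k) (hr : k.den ∣ r) : (numer r k : ℚ) = k * r := by
  obtain ⟨c, rfl⟩ := hr
  have hnum : (k.num.natAbs : ℚ) = k.num := by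
    rw [Nat.cast_natAbs, abs_of_nonneg (Rat.num_nonneg.2 hk)]
  rw [numer_den_mul, Nat.cast_mul, Nat.cast_mul, hnum, ← mul_assoc, Rat.mul_den_eq_num]

lemma dvd_numer_mul_iff {k : ℚ} {c d : ℕ} (hc : 0 < c) (hk : k.den ∣ c * d) :
    c ∣ numer (c * d) k ↔ k.den ∣ d := by
  obtain ⟨e, he⟩ := hk
  have hnum : k.den * numer (c * d) k = c * (k.num.natAbs * d) := by
    rw [he, numer_den_mul, mul_left_comm, ← he, mul_left_comm]
  rw [← Nat.mul_dvd_mul_iff_left k.den_pos, hnum, mul_comm k.den, Nat.mul_dvd_mul_iff_left hc,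
    k.reduced.symm.dvd_mul_left]

lemma lcm_den_mul_gcdOf {r : ℕ} {S : Finset ℚ} (hr : 0 < r) (hS : ∀ k ∈ S, k.den ∣ r) :
    S.lcm Rat.den * gcdOf r S = r := by
  have dvd_gcdOf_iff : ∀ c d, c * d = r → (c ∣ gcdOf r S ↔ S.lcm Rat.den ∣ d) := by
    rintro c d rfl
    simp only [gcdOf, Nat.dvd_gcd_iff, dvd_mul_right, true_and, Finset.dvd_gcd_iff,
      Finset.lcm_dvd_iff]
    exact forall₂_congr fun k hk ↦ dvd_numer_mul_iff (Nat.pos_of_mul_pos_right hr) (hS k hk)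
  obtain ⟨d, hd⟩ : gcdOf r S ∣ r := Nat.gcd_dvd_left _ _
  obtain ⟨c, hc⟩ : S.lcm Rat.den ∣ r := Finset.lcm_dvd hS
  refine Nat.dvd_antisymm ?_ ?_
  · conv_rhs => rw [hd, mul_comm]
    exact mul_dvd_mul_right ((dvd_gcdOf_iff _ d hd.symm).1 dvd_rfl) _
  · conv_lhs => rw [hc]
    exact mul_dvd_mul_left _ ((dvd_gcdOf_iff c _ ((mul_comm _ _).trans hc.symm)).2 dvd_rfl)

lemma natCast_gcdOf {r : ℕ} {S : Finset ℚ} (hr : 0 < r) (hS : ∀ k ∈ S, k.den ∣ r) :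
    (gcdOf r S : ℚ) = r * fixedProportion S := by
  have hlcm : ((S.lcm Rat.den : ℕ) : ℚ) ≠ 0 := by exact_mod_cast (lcm_den_pos S).ne'
  rw [fixedProportion, eq_mul_inv_iff_mul_eq₀ hlcm, mul_comm]
  exact_mod_cast lcm_den_mul_gcdOf hr hS

lemma intCast_levelSum {r r' : ℕ} {S : Finset ℚ} (hr' : 0 < r') (hS₀ : ∀ k ∈ S, 0 ≤ k)
    (hS : ∀ k ∈ S, k.den ∣ r) (hS' : ∀ k ∈ S, k.den ∣ r') :
    (levelSum r r' S : ℚ) = r * r' * ∑ k ∈ S, k * topMovedProportion S k := by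
  rw [levelSum, Int.cast_sum, Finset.mul_sum]
  refine Finset.sum_congr rfl fun k hk ↦ ?_
  have hgcd (p : ℚ → Prop) [DecidablePred p] :
      (gcdOf r' (S.filter p) : ℚ) = r' * fixedProportion (S.filter p) :=
    natCast_gcdOf hr' fun l hl ↦ hS' l (Finset.mem_of_mem_filter l hl)
  push_cast
  rw [natCast_numer (hS₀ k hk) (hS k hk), hgcd, hgcd, topMovedProportion]
  ring

/-! ### Truncations of Stokes circles -/

namespace StokesCircle

lemma exponents_pos (I : StokesCircle) : ∀ k ∈ I.exponents, 0 < k := by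
  induction I using Quotient.inductionOn with
  | h q => exact q.2

lemma ram_pos (I : StokesCircle) : 0 < I.ram := lcm_den_pos _

lemma den_dvd_ram {I : StokesCircle} {k : ℚ} (hk : k ∈ I.exponents) : k.den ∣ I.ram :=
  Finset.dvd_lcm hk

lemma exponents_trunc (I : StokesCircle) (l : ℚ) :
    (I.trunc l).exponents = I.exponents.filter (l ≤ ·) := by
  induction I using Quotient.inductionOn with
  | h q => exact Finsupp.support_filter _ _

lemma eq_of_exponents_eq_empty {I J : StokesCircle} (hI : I.exponents = ∅)
    (hJ : J.exponents = ∅) : I = J := by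
  induction I using Quotient.inductionOn with
  | h q =>
    induction J using Quotient.inductionOn with
    | h q' =>
      exact congrArg circ <| Subtype.ext <|
        (Finsupp.support_eq_empty.1 hI).trans (Finsupp.support_eq_empty.1 hJ).symm

lemma trunc_congr (I : StokesCircle) {l l' : ℚ} (h : ∀ k ∈ I.exponents, l ≤ k ↔ l' ≤ k) :
    I.trunc l = I.trunc l' := by
  induction I using Quotient.inductionOn with
  | h q =>
    refine congrArg circ (Subtype.ext (Finsupp.ext fun k ↦ ?_))
    change q.1.filter (l ≤ ·) k = q.1.filter (l' ≤ ·) k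
    by_cases hk : q.1 k = 0
    · simp [Finsupp.filter_apply, hk]
    · simp [Finsupp.filter_apply, h k (Finsupp.mem_support_iff.2 hk)]

lemma trunc_trunc (I : StokesCircle) {l l' : ℚ} (h : l ≤ l') :
    (I.trunc l).trunc l' = I.trunc l' := by
  induction I using Quotient.inductionOn with
  | h q =>
    refine congrArg circ (Subtype.ext (Finsupp.ext fun k ↦ ?_))
    change (q.1.filter (l ≤ ·)).filter (l' ≤ ·) k = q.1.filter (l' ≤ ·) k
    by_cases hk : l' ≤ k
    · simp [hk, h.trans hk]
    · simp [hk]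

lemma trunc_eq_trunc_of_le {I J : StokesCircle} {l l' : ℚ} (hl : l ≤ l')
    (h : I.trunc l = J.trunc l) : I.trunc l' = J.trunc l' := by
  rw [← I.trunc_trunc hl, h, J.trunc_trunc hl]

lemma trunc_eq_self (I : StokesCircle) {l : ℚ} (h : ∀ k ∈ I.exponents, l ≤ k) :
    I.trunc l = I := by
  induction I using Quotient.inductionOn with
  | h q =>
    exact congrArg circ <| Subtype.ext <| (Finsupp.filter_eq_self_iff _ _).2 fun k hk ↦
      h k (Finsupp.mem_support_iff.2 hk)

lemma exists_nat_trunc_eq_trunc (I J : StokesCircle) {L : ℕ} (hL : 0 < L) :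
    ∃ n : ℕ, 0 < n ∧ I.trunc ((n : ℚ) / L) = J.trunc ((n : ℚ) / L) := by
  obtain ⟨M, hM⟩ := (I.exponents ∪ J.exponents).bddAbove
  obtain ⟨n, hn⟩ := exists_nat_gt (max M 0 * L)
  have hL' : (0 : ℚ) < L := by exact_mod_cast hL
  have hlt : max M 0 < (n : ℚ) / L := (lt_div_iff₀ hL').2 hn
  have hn₀ : (0 : ℚ) < n := (mul_nonneg (le_max_right _ _) hL'.le).trans_lt hn
  have trunc_empty (K : StokesCircle) (hK : K.exponents ⊆ I.exponents ∪ J.exponents) :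
      (K.trunc ((n : ℚ) / L)).exponents = ∅ := by
    rw [exponents_trunc, Finset.filter_eq_empty_iff]
    exact fun k hk ↦ not_le.2 <| ((hM (hK hk)).trans (le_max_left _ _)).trans_lt hlt
  exact ⟨n, by exact_mod_cast hn₀, eq_of_exponents_eq_empty
    (trunc_empty I Finset.subset_union_left) (trunc_empty J Finset.subset_union_right)⟩

end StokesCircle

lemma commonIndex_comm (I J : StokesCircle) : commonIndex I J = commonIndex J I := by
  simp only [commonIndex, Nat.lcm_comm I.ram J.ram, eq_comm (a := I.trunc _)]

lemma commonIndex_pos_and_trunc_eq (I J : StokesCircle) :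
    0 < commonIndex I J ∧ I.trunc (commonIndex I J) = J.trunc (commonIndex I J) := by
  have hL : 0 < Nat.lcm I.ram J.ram := Nat.lcm_pos I.ram_pos J.ram_pos
  obtain ⟨hpos, htrunc⟩ := Nat.sInf_mem (I.exists_nat_trunc_eq_trunc J hL)
  exact ⟨div_pos (by exact_mod_cast hpos) (by exact_mod_cast hL), htrunc⟩

lemma commonIndex_pos (I J : StokesCircle) : 0 < commonIndex I J :=
  (commonIndex_pos_and_trunc_eq I J).1

lemma trunc_commonIndex (I J : StokesCircle) :
    I.trunc (commonIndex I J) = J.trunc (commonIndex I J) :=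
  (commonIndex_pos_and_trunc_eq I J).2

lemma commonIndex_le {I J : StokesCircle} {l : ℚ} (hl : 0 < l)
    (hden : l.den ∣ Nat.lcm I.ram J.ram) (h : I.trunc l = J.trunc l) : commonIndex I J ≤ l := by
  have hL : (0 : ℚ) < Nat.lcm I.ram J.ram := by
    exact_mod_cast Nat.lcm_pos I.ram_pos J.ram_pos
  have hn : (numer (Nat.lcm I.ram J.ram) l : ℚ) = l * Nat.lcm I.ram J.ram :=
    natCast_numer hl.le hden
  have hn' : (numer (Nat.lcm I.ram J.ram) l : ℚ) / Nat.lcm I.ram J.ram = l := by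
    rw [hn, mul_div_cancel_right₀ _ hL.ne']
  rw [commonIndex, div_le_iff₀ hL, ← hn, Nat.cast_le]
  refine Nat.sInf_le ⟨?_, by rw [hn', h]⟩
  exact_mod_cast hn ▸ mul_pos hl hL

/-! ### The fission exponent of two Stokes circles -/

lemma le_slopeOf {S : Finset ℚ} {k : ℚ} (hk : k ∈ S) : k ≤ slopeOf S := by
  rw [slopeOf, dif_pos ⟨k, hk⟩]
  exact S.le_max' k hk

lemma slopeOf_mem {S : Finset ℚ} (h : slopeOf S ≠ 0) : slopeOf S ∈ S := by
  unfold slopeOf at h ⊢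
  split_ifs at h ⊢ with hS
  · exact S.max'_mem hS
  · exact absurd rfl h

/-- The fission exponent of `I` and `J`: the largest exponent of the different parts `q_d`, `q'_d`
of `I = ⟨q⟩` and `J = ⟨q'⟩`. -/
noncomputable def fissionExponent (I J : StokesCircle) : ℚ := max (diffSlope I J) (diffSlope J I)

lemma fissionExponent_comm (I J : StokesCircle) : fissionExponent I J = fissionExponent J I :=
  max_comm _ _

lemma diffSlope_mem {I J : StokesCircle} (h : diffSlope I J ≠ 0) : diffSlope I J ∈ I.exponents :=
  Finset.mem_of_mem_filter _ (slopeOf_mem h)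

lemma diffSlope_lt_commonIndex (I J : StokesCircle) : diffSlope I J < commonIndex I J := by
  by_cases h : diffSlope I J = 0
  · exact h ▸ commonIndex_pos I J
  · exact (Finset.mem_filter.1 (slopeOf_mem h)).2

lemma fissionExponent_lt_commonIndex (I J : StokesCircle) :
    fissionExponent I J < commonIndex I J :=
  max_lt (diffSlope_lt_commonIndex I J) (commonIndex_comm I J ▸ diffSlope_lt_commonIndex J I)

lemma commonIndex_le_iff_fissionExponent_lt {I : StokesCircle} (J : StokesCircle) {k : ℚ}
    (hk : k ∈ I.exponents) : commonIndex I J ≤ k ↔ fissionExponent I J < k := by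
  refine ⟨(fissionExponent_lt_commonIndex I J).trans_le, fun h ↦ not_lt.1 fun hlt ↦ ?_⟩
  have hle : k ≤ diffSlope I J := le_slopeOf (Finset.mem_filter.2 ⟨hk, hlt⟩)
  exact (hle.trans (le_max_left _ _)).not_gt h

lemma trunc_eq_trunc_of_fissionExponent_lt {I J : StokesCircle} {l : ℚ}
    (hl : fissionExponent I J < l) : I.trunc l = J.trunc l := by
  have trunc_min (K K' : StokesCircle) (h : fissionExponent K K' < l) :
      K.trunc (min l (commonIndex K K')) = K.trunc (commonIndex K K') :=
    K.trunc_congr fun k hk ↦ by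
      rw [min_le_iff, or_iff_right_of_imp]
      exact fun hlk ↦ (commonIndex_le_iff_fissionExponent_lt K' hk).2 (h.trans_le hlk)
  refine StokesCircle.trunc_eq_trunc_of_le (min_le_left l (commonIndex I J)) ?_
  rw [trunc_min I J hl, trunc_commonIndex, commonIndex_comm,
    trunc_min J I (fissionExponent_comm I J ▸ hl)]

lemma fissionExponent_pos {I J : StokesCircle} (hIJ : I ≠ J) : 0 < fissionExponent I J := by
  by_contra! h
  have trunc_self (K K' : StokesCircle) (h : fissionExponent K K' ≤ 0) :
      K.trunc (commonIndex K K') = K :=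
    K.trunc_eq_self fun k hk ↦
      (commonIndex_le_iff_fissionExponent_lt K' hk).2 (h.trans_lt (K.exponents_pos k hk))
  refine hIJ ?_
  rw [← trunc_self I J h, trunc_commonIndex, commonIndex_comm,
    trunc_self J I (fissionExponent_comm I J ▸ h)]

lemma fissionExponent_mem {I J : StokesCircle} (hIJ : I ≠ J) :
    fissionExponent I J ∈ I.exponents ∪ J.exponents := by
  have hpos := fissionExponent_pos hIJ
  rw [Finset.mem_union]
  rcases max_choice (diffSlope I J) (diffSlope J I) with h | h <;>
    rw [fissionExponent, h] at hpos ⊢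
  · exact Or.inl (diffSlope_mem hpos.ne')
  · exact Or.inr (diffSlope_mem hpos.ne')

lemma trunc_eq_trunc_iff {I J : StokesCircle} (hIJ : I ≠ J) {l : ℚ} :
    I.trunc l = J.trunc l ↔ fissionExponent I J < l := by
  refine ⟨fun h ↦ not_le.1 fun hl ↦ ?_, trunc_eq_trunc_of_fissionExponent_lt⟩
  have hden : (fissionExponent I J).den ∣ Nat.lcm I.ram J.ram := by
    rcases Finset.mem_union.1 (fissionExponent_mem hIJ) with hI | hJ
    · exact (StokesCircle.den_dvd_ram hI).trans (Nat.dvd_lcm_left _ _)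
    · exact (StokesCircle.den_dvd_ram hJ).trans (Nat.dvd_lcm_right _ _)
  exact (fissionExponent_lt_commonIndex I J).not_ge <|
    commonIndex_le (fissionExponent_pos hIJ) hden (StokesCircle.trunc_eq_trunc_of_le hl h)

lemma fissionExponent_le_max {I J K : StokesCircle} (hJK : J ≠ K) :
    fissionExponent J K ≤ max (fissionExponent I J) (fissionExponent I K) := by
  by_contra! h
  obtain ⟨hIJ, hIK⟩ := max_lt_iff.1 h
  refine lt_irrefl _ ((trunc_eq_trunc_iff hJK).1 ?_)
  rw [← trunc_eq_trunc_of_fissionExponent_lt hIJ, trunc_eq_trunc_of_fissionExponent_lt hIK]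

/-! ### The ultrametric inequality -/

lemma exponents_commonPart (I J : StokesCircle) :
    (commonPart I J).exponents = I.exponents.filter (fissionExponent I J < ·) := by
  rw [commonPart, StokesCircle.exponents_trunc]
  exact Finset.filter_congr fun k hk ↦ commonIndex_le_iff_fissionExponent_lt J hk

lemma commonPart_comm (I J : StokesCircle) : commonPart I J = commonPart J I := by
  rw [commonPart, trunc_commonIndex, commonIndex_comm, commonPart]

lemma averageSlope_exponents_comm (I J : StokesCircle) :
    averageSlope I.exponents (fissionExponent I J)
      = averageSlope J.exponents (fissionExponent I J) := by
  rw [← averageSlope_filter_lt, ← exponents_commonPart, commonPart_comm, exponents_commonPart,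
    fissionExponent_comm J I, averageSlope_filter_lt]

lemma edgeFormula_div_ram {I J : StokesCircle} (hIJ : I ≠ J)
    (hle : diffSlope J I ≤ diffSlope I J) :
    (edgeFormula I J : ℚ) / (I.ram * J.ram)
      = averageSlope I.exponents (fissionExponent I J) - 1 := by
  have hf : diffSlope I J = fissionExponent I J := (max_eq_left hle).symm
  have hpos : 0 < fissionExponent I J := fissionExponent_pos hIJ
  have hfI : fissionExponent I J ∈ I.exponents := hf ▸ diffSlope_mem (hf.trans_ne hpos.ne')
  have hSI : (commonPart I J).exponents ⊆ I.exponents := by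
    rw [exponents_commonPart]
    exact Finset.filter_subset _ _
  have hSJ : (commonPart I J).exponents ⊆ J.exponents := by
    rw [commonPart_comm, exponents_commonPart]
    exact Finset.filter_subset _ _
  have hlt : ∀ k ∈ (commonPart I J).exponents, fissionExponent I J < k := fun k hk ↦
    (Finset.mem_filter.1 (exponents_commonPart I J ▸ hk)).2
  have hlevel := intCast_levelSum J.ram_pos (fun k hk ↦ (I.exponents_pos k (hSI hk)).le)
    (fun k hk ↦ StokesCircle.den_dvd_ram (hSI hk)) fun k hk ↦ StokesCircle.den_dvd_ram (hSJ hk)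
  have hgcd := natCast_gcdOf J.ram_pos fun k hk ↦ StokesCircle.den_dvd_ram (hSJ hk)
  have hI : (I.ram : ℚ) ≠ 0 := by exact_mod_cast I.ram_pos.ne'
  have hJ : (J.ram : ℚ) ≠ 0 := by exact_mod_cast J.ram_pos.ne'
  rw [← averageSlope_filter_lt, ← exponents_commonPart, averageSlope_of_forall_lt hlt,
    edgeFormula, hf]
  push_cast
  rw [hlevel, hgcd, natCast_numer hpos.le (StokesCircle.den_dvd_ram hfI)]
  field_simp

lemma mult_div_ram {I J : StokesCircle} (hIJ : I ≠ J) :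
    (mult I J : ℚ) / (I.ram * J.ram) = averageSlope I.exponents (fissionExponent I J) - 1 := by
  rw [mult, if_neg hIJ, edgeMult]
  split_ifs with hle
  · exact edgeFormula_div_ram hIJ hle
  · rw [averageSlope_exponents_comm, fissionExponent_comm, mul_comm]
    exact edgeFormula_div_ram hIJ.symm (not_le.1 hle).le

theorem mult_div_ram_le_max {I J K : StokesCircle} (hIJ : I ≠ J) (hIK : I ≠ K) (hJK : J ≠ K) :
    (mult J K : ℚ) / (J.ram * K.ram)
      ≤ max ((mult I J : ℚ) / (I.ram * J.ram)) ((mult I K : ℚ) / (I.ram * K.ram)) := by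
  rw [mult_div_ram hIJ, mult_div_ram hIK, mult_div_ram hJK]
  rcases le_max_iff.1 (fissionExponent_le_max (I := I) hJK) with h | h
  · rw [averageSlope_exponents_comm I J]
    exact le_max_of_le_left (sub_le_sub_right (averageSlope_monotone _ h) 1)
  · rw [averageSlope_exponents_comm J K, averageSlope_exponents_comm I K]
    exact le_max_of_le_right (sub_le_sub_right (averageSlope_monotone _ h) 1)

theorem Diagram.IsCoreDiagram.exists_rescaledUltrametric {Γ : Diagram} {Θ : StokesCircle →₀ ℕ}
    (h : Γ.IsCoreDiagram Θ) : ∃ r : Γ.V → ℕ, (∀ i, 1 ≤ r i) ∧ Γ.RescaledUltrametric r := by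
  obtain ⟨e, he⟩ := h
  have hne {i j : Γ.V} (hij : i ≠ j) : (e i : StokesCircle) ≠ e j := fun h ↦
    hij (e.injective (Subtype.ext h))
  refine ⟨fun i ↦ (e i : StokesCircle).ram, fun i ↦ StokesCircle.ram_pos _, ?_⟩
  intro i j k hij hik hjk hij_le hik_le
  refine le_antisymm hik_le ?_
  simp only [Diagram.rescaled, if_neg hij, if_neg hik, if_neg hjk, he] at hij_le ⊢
  exact (mult_div_ram_le_max (hne hij) (hne hik) (hne hjk)).trans_eq (max_eq_right hij_le)

/-! ### The triangle -/

lemma triangle_isGraph : triangle.IsGraph := by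
  refine ⟨fun (i j : Fin 3) ↦ ?_, fun (i : Fin 3) ↦ ?_⟩
  · fin_cases i <;> fin_cases j <;> decide
  · fin_cases i <;> rfl

lemma triangle_not_rescaledUltrametric (r : triangle.V → ℕ) (hr : ∀ i, 1 ≤ r i) :
    ¬ triangle.RescaledUltrametric r := by
  intro h
  have hrescaled (i j : Fin 3) (hij : i ≠ j) :
      triangle.rescaled r i j = (triangle.B i j : ℚ) / ((r i : ℚ) * (r j : ℚ)) := if_neg hij
  have h₀₁ : triangle.rescaled r (0 : Fin 3) (1 : Fin 3) = 0 := by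
    rw [hrescaled 0 1 (by decide), show triangle.B (0 : Fin 3) (1 : Fin 3) = 0 from rfl,
      Int.cast_zero, zero_div]
  have h₀₂ : triangle.rescaled r (0 : Fin 3) (2 : Fin 3) = 0 := by
    rw [hrescaled 0 2 (by decide), show triangle.B (0 : Fin 3) (2 : Fin 3) = 0 from rfl,
      Int.cast_zero, zero_div]
  have h₁₂ : 0 < triangle.rescaled r (1 : Fin 3) (2 : Fin 3) := by
    have h₁ : (0 : ℚ) < r (1 : Fin 3) := by exact_mod_cast hr (1 : Fin 3)
    have h₂ : (0 : ℚ) < r (2 : Fin 3) := by exact_mod_cast hr (2 : Fin 3)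
    rw [hrescaled 1 2 (by decide), show triangle.B (1 : Fin 3) (2 : Fin 3) = 1 from rfl]
    positivity
  have h_eq := h (0 : Fin 3) (1 : Fin 3) (2 : Fin 3) (by decide : (0 : Fin 3) ≠ 1)
    (by decide : (0 : Fin 3) ≠ 2) (by decide : (1 : Fin 3) ≠ 2) (h₀₁.trans h₀₂.symm).le
    (h₀₂.trans_lt h₁₂).le
  exact h₁₂.ne (h₀₂.symm.trans h_eq)

lemma triangle_not_isNonabelianHodgeDiagram : ¬ triangle.IsNonabelianHodgeDiagram := by
  rintro ⟨_, Θ, _, hΘ⟩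
  obtain ⟨r, hr, hultra⟩ := hΘ.exists_rescaledUltrametric
  exact triangle_not_rescaledUltrametric r hr hultra

end NAH

theorem proposition4p4 :
    (∃ Γ : NAH.Diagram, Γ.IsGraph ∧ ¬ Γ.IsNonabelianHodgeGraph) ∧
    (∃ Γ : NAH.Diagram, ¬ Γ.IsNonabelianHodgeDiagram) ∧
    NAH.triangle.IsGraph ∧ ¬ NAH.triangle.IsNonabelianHodgeGraph ∧
    ∀ r : NAH.triangle.V → ℕ, (∀ i, 1 ≤ r i) → ¬ NAH.triangle.RescaledUltrametric r := by
  have not_hodgeGraph : ¬ NAH.triangle.IsNonabelianHodgeGraph := fun h ↦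
    NAH.triangle_not_isNonabelianHodgeDiagram h.1
  exact ⟨⟨NAH.triangle, NAH.triangle_isGraph, not_hodgeGraph⟩,
    ⟨NAH.triangle, NAH.triangle_not_isNonabelianHodgeDiagram⟩,
    NAH.triangle_isGraph, not_hodgeGraph, NAH.triangle_not_rescaledUltrametric⟩
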